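/- Let $n\ge 1$ and $d\ge 0$ be integers, and let $\mathrm{Sp}_{2n}(\mathbb C)$ be the group of complex $2n\times 2n$ matrices preserving the standard form $\Omega=\begin{bmatrix}0&I_n\\-I_n&0\end{bmatrix}$. For a symmetric $n\times n$ matrix $Z$ and an upper unitriangular $n\times n$ matrix $A$ (upper triangular with ones on the diagonal) put $$M^-(Z)=\begin{bmatrix}I_n&0\\Z&I_n\end{bmatrix},\quad M^+(Z)=\begin{bmatrix}I_n&Z\\0&I_n\end{bmatrix},\quad M^-(A,Z)=M^-(Z)\begin{bmatrix}A^{-T}&0\\0&A\end{bmatrix},\quad M^+(A,Z)=M^+(Z)\begin{bmatrix}A^{-1}&0\\0&A^{T}\end{bmatrix}.$$ The matrices $M^\pm(Z)$ are the unitriangular $\Omega$-symplectic matrices; the matrices $M^\pm(A,Z)$ are, after reversing the order of the last $n$ basis vectors, the unitriangular symplectic matrices for the form $\tilde\Omega=\begin{bmatrix}0&L_n\\-L_n&0\end{bmatrix}$, where $L_n$ is the $n\times n$ matrix with ones along the skew-diagonal and zeros elsewhere. Let $K_{symp}(n,d)$ be the smallest natural number $K$ such that for every reduced Stein space $X$ of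 dimension $d$ and every null-homotopic holomorphic map $f:X\to\mathrm{Sp}_{2n}(\mathbb C)$ there are holomorphic maps $Z_1,\dots,Z_K$ from $X$ to the symmetric $n\times n$ matrices with $$f(x)=M^-(Z_1(x))\,M^+(Z_2(x))\cdots M^{\pm}(Z_K(x))\qquad(x\in X).$$ Let $\tilde K_{symp}(n,d)$ be the smallest natural number $K$ such that for all such $X$ and $f$ there are holomorphic maps $A_1,\dots,A_K$ from $X$ to the upper unitriangular and $Z_1,\dots,Z_K$ from $X$ to the symmetric $n\times n$ matrices with $$f(x)=M^-(A_1(x),Z_1(x))\,M^+(A_2(x),Z_2(x))\cdots M^{\pm}(A_K(x),Z_K(x))\qquad(x\in X).$$ (Either number is $\infty$ if there is no such $K$.) Then for every $n\ge 4$ $$K_{symp}(n,d)\le 7\,\tilde K_{symp}(n,d)\ \text{ for all } d\ge 0,\qquad\text{and}\qquad 6\le K_{symp}(n,d)\ \text{ for all } d\ge 1,$$ and for $n=2$ and $n=3$ $$K_{symp}(n,d)\le 4\,\tilde K_{symp}(n,d)\ \text{ for all } d\ge 0.$$ -/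

import Mathlib

/-! ### Reduced complex spaces -/

/-- `A` is an analytic subset of the open set `W ⊆ ℂᴺ`: near every point of `W` it is the common
zero set of finitely many holomorphic functions. -/
def IsAnalyticSubset {N : ℕ} (W A : Set (Fin N → ℂ)) : Prop :=
  IsOpen W ∧ A ⊆ W ∧ ∀ z ∈ W, ∃ V : Set (Fin N → ℂ), IsOpen V ∧ z ∈ V ∧ V ⊆ W ∧
    ∃ (m : ℕ) (g : Fin m → (Fin N → ℂ) → ℂ), (∀ i, AnalyticOnNhd ℂ (g i) V) ∧
      A ∩ V = {w ∈ V | ∀ i, g i w = 0}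

/-- `HolAt f y` is read as "the germ of `f` at `y` is holomorphic". The map `φ` is a chart on the
open set `U` for this notion of holomorphy if it is a homeomorphism of `U` onto its image in `ℂᴺ`
under which the holomorphic germs are exactly the restrictions to the image of germs of
holomorphic functions on `ℂᴺ`. -/
def IsHolChart {X : Type*} [TopologicalSpace X] (HolAt : (X → ℂ) → X → Prop) {N : ℕ}
    (U : Set X) (φ : X → (Fin N → ℂ)) : Prop :=
  IsOpen U ∧ Topology.IsEmbedding (U.domRestrict φ) ∧
    ∀ y ∈ U, ∀ f : X → ℂ, HolAt f y ↔
      ∃ g : (Fin N → ℂ) → ℂ, AnalyticAt ℂ g (φ y) ∧ f =ᶠ[nhds y] g ∘ φ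

/-- The structure of a reduced complex space on a topological space `X`: a sheaf of complex-valued
functions, given by its germs `HolAt`, which is locally isomorphic to an analytic subset `A` of an
open subset of some `ℂᴺ` with the restrictions of holomorphic functions to `A`. -/
structure ReducedComplexStructure (X : Type*) [TopologicalSpace X] where
  /-- The germ of the function at the point is holomorphic. -/
  HolAt : (X → ℂ) → X → Prop
  exists_chart : ∀ x : X, ∃ (N : ℕ) (U : Set X) (φ : X → (Fin N → ℂ)) (W : Set (Fin N → ℂ)),
    x ∈ U ∧ IsHolChart HolAt U φ ∧ IsAnalyticSubset W (φ '' U)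

namespace ReducedComplexStructure

variable {X : Type*} [TopologicalSpace X] (𝒪 : ReducedComplexStructure X)

/-- Holomorphic functions on `X`. -/
def Hol (f : X → ℂ) : Prop := ∀ x, 𝒪.HolAt f x

/-- Holomorphic matrix-valued maps on `X`. -/
def HolMatrix {m n : Type*} (F : X → Matrix m n ℂ) : Prop :=
  ∀ i j, 𝒪.Hol fun x => F x i j

/-- `x` is a regular point of dimension `k`: a neighbourhood of `x` is biholomorphic to an open
subset of `ℂᵏ`. -/
def IsRegularPoint (x : X) (k : ℕ) : Prop :=
  ∃ (U : Set X) (φ : X → (Fin k → ℂ)), x ∈ U ∧ IsHolChart 𝒪.HolAt U φ ∧ IsOpen (φ '' U)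

/-- `X` has dimension `d`: the largest dimension of `X` at its regular points (these form a dense
subset of a reduced complex space) is `d`. -/
def HasDim (d : ℕ) : Prop := IsGreatest {k : ℕ | ∃ x, 𝒪.IsRegularPoint x k} d

/-- The holomorphically convex hull of `K`. -/
def hull (K : Set X) : Set X :=
  {x | ∀ f, 𝒪.Hol f → ∀ C : ℝ, (∀ y ∈ K, ‖f y‖ ≤ C) → ‖f x‖ ≤ C}

/-- `X` is a Stein space: it is Hausdorff with countable topology, holomorphically convex and
holomorphically separable. -/
structure IsStein : Prop where
  t2 : T2Space X
  secondCountable : SecondCountableTopology X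
  convex : ∀ K : Set X, IsCompact K → IsCompact (𝒪.hull K)
  separable : ∀ x y : X, x ≠ y → ∃ f, 𝒪.Hol f ∧ f x ≠ f y

end ReducedComplexStructure

/-! ### Unitriangular factors -/

section Factors

variable {n : ℕ}

/-- `M⁻(Z)`, lower unitriangular for `Ω = [0, I; -I, 0]` when `Z` is symmetric. -/
def Mminus (Z : Matrix (Fin n) (Fin n) ℂ) : Matrix (Fin n ⊕ Fin n) (Fin n ⊕ Fin n) ℂ :=
  Matrix.fromBlocks 1 0 Z 1

/-- `M⁺(Z)`, upper unitriangular for `Ω` when `Z` is symmetric. -/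
def Mplus (Z : Matrix (Fin n) (Fin n) ℂ) : Matrix (Fin n ⊕ Fin n) (Fin n ⊕ Fin n) ℂ :=
  Matrix.fromBlocks 1 Z 0 1

/-- `A` is upper triangular with ones on the diagonal. -/
def IsUpperUnitriangular (A : Matrix (Fin n) (Fin n) ℂ) : Prop :=
  (∀ i, A i i = 1) ∧ ∀ i j, j < i → A i j = 0

/-- `M⁻(A, Z)`: for `A` upper unitriangular and `Z` symmetric these are the matrices that become
the lower unitriangular `Ω̃`-symplectic ones after reversing the last `n` basis vectors, where
`Ω̃ = [0, L; -L, 0]` with `L` the matrix with ones along the skew-diagonal. -/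
noncomputable def MminusTilde (A Z : Matrix (Fin n) (Fin n) ℂ) :
    Matrix (Fin n ⊕ Fin n) (Fin n ⊕ Fin n) ℂ :=
  Matrix.fromBlocks 1 0 Z 1 * Matrix.fromBlocks (A⁻¹).transpose 0 0 A

/-- `M⁺(A, Z)`: the same for upper unitriangular `Ω̃`-symplectic matrices. -/
noncomputable def MplusTilde (A Z : Matrix (Fin n) (Fin n) ℂ) :
    Matrix (Fin n ⊕ Fin n) (Fin n ⊕ Fin n) ℂ :=
  Matrix.fromBlocks 1 Z 0 1 * Matrix.fromBlocks A⁻¹ 0 0 A.transpose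

/-- `f = M⁻(Z₁) M⁺(Z₂) M⁻(Z₃) ⋯` with `K` factors and holomorphic symmetric `Z₁, …, Z_K`. (The
index `k` starts at `0`, so the even `k` carry the lower factors.) -/
def FactorsOmega {X : Type*} [TopologicalSpace X] (𝒪 : ReducedComplexStructure X)
    (f : X → Matrix (Fin n ⊕ Fin n) (Fin n ⊕ Fin n) ℂ) (K : ℕ) : Prop :=
  ∃ Z : Fin K → X → Matrix (Fin n) (Fin n) ℂ,
    (∀ k, 𝒪.HolMatrix (Z k)) ∧ (∀ k x, (Z k x).IsSymm) ∧
    ∀ x, f x = (List.ofFn fun k : Fin K =>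
      if Even (k : ℕ) then Mminus (Z k x) else Mplus (Z k x)).prod

/-- `f = M⁻(A₁, Z₁) M⁺(A₂, Z₂) M⁻(A₃, Z₃) ⋯` with `K` factors, holomorphic upper unitriangular
`A₁, …, A_K` and holomorphic symmetric `Z₁, …, Z_K`. -/
def FactorsOmegaTilde {X : Type*} [TopologicalSpace X] (𝒪 : ReducedComplexStructure X)
    (f : X → Matrix (Fin n ⊕ Fin n) (Fin n ⊕ Fin n) ℂ) (K : ℕ) : Prop :=
  ∃ A Z : Fin K → X → Matrix (Fin n) (Fin n) ℂ,
    (∀ k, 𝒪.HolMatrix (A k)) ∧ (∀ k x, IsUpperUnitriangular (A k x)) ∧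
    (∀ k, 𝒪.HolMatrix (Z k)) ∧ (∀ k x, (Z k x).IsSymm) ∧
    ∀ x, f x = (List.ofFn fun k : Fin K =>
      if Even (k : ℕ) then MminusTilde (A k x) (Z k x) else MplusTilde (A k x) (Z k x)).prod

end Factors

/-- On every `d`-dimensional reduced Stein space, every null-homotopic holomorphic map to
`Sp₂ₙ(ℂ)` is a product of `K` unitriangular factors for `Ω`. (Spaces in `Type` are all there are up
to isomorphism, since a second countable Hausdorff space has at most continuum many points.) -/
def SufficesOmega (n d K : ℕ) : Prop :=
  ∀ (X : Type) [TopologicalSpace X] (𝒪 : ReducedComplexStructure X), 𝒪.IsStein → 𝒪.HasDim d →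
    ∀ f : C(X, Matrix.symplecticGroup (Fin n) ℂ), f.Nullhomotopic →
      𝒪.HolMatrix (fun x => (f x : Matrix (Fin n ⊕ Fin n) (Fin n ⊕ Fin n) ℂ)) →
      FactorsOmega 𝒪 (fun x => (f x : Matrix (Fin n ⊕ Fin n) (Fin n ⊕ Fin n) ℂ)) K

/-- On every `d`-dimensional reduced Stein space, every null-homotopic holomorphic map to
`Sp₂ₙ(ℂ)` is a product of `K` unitriangular factors for `Ω̃`. -/
def SufficesOmegaTilde (n d K : ℕ) : Prop :=
  ∀ (X : Type) [TopologicalSpace X] (𝒪 : ReducedComplexStructure X), 𝒪.IsStein → 𝒪.HasDim d →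
    ∀ f : C(X, Matrix.symplecticGroup (Fin n) ℂ), f.Nullhomotopic →
      𝒪.HolMatrix (fun x => (f x : Matrix (Fin n ⊕ Fin n) (Fin n ⊕ Fin n) ℂ)) →
      FactorsOmegaTilde 𝒪 (fun x => (f x : Matrix (Fin n ⊕ Fin n) (Fin n ⊕ Fin n) ℂ)) K

/-- The minimal number of unitriangular factors for `Ω` (`⊤` if no number suffices). -/
noncomputable def Ksymp (n d : ℕ) : ℕ∞ := ⨅ (K : ℕ) (_ : SufficesOmega n d K), (K : ℕ∞)

/-- The minimal number of unitriangular factors for `Ω̃` (`⊤` if no number suffices). -/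
noncomputable def KsympTilde (n d : ℕ) : ℕ∞ := ⨅ (K : ℕ) (_ : SufficesOmegaTilde n d K), (K : ℕ∞)

/-!
A factorization over a Stein space is a factorization over its ring `R` of holomorphic functions,
so everything reduces to writing a block diagonal matrix `D(A) = diag(A⁻ᵀ, A)` over a commutative
ring as an alternating product of unipotent blocks with symmetric parameters.

If `A - 1 = Y Z` with `Y`, `Z` symmetric, then `D(A)` is a product of four such blocks. For `n ≤ 3`
every upper unitriangular `A` has this property. In general let `J` be the subdiagonal shift: the
matrices `A (1 + J) - 1` and `J` are upper Hessenberg with ones on the subdiagonal, hence conjugate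
to a companion matrix over any ring, and products of two symmetric matrices because `Q H P` is a
Hankel matrix when `P` and `Q` are the Krylov matrices of `H`. So `D(A) = D(A (1 + J)) D(1 + J)⁻¹`
is a product of `4 + 4` blocks, of which the two adjacent middle ones merge. As seven is odd, these
products concatenate; when `n ≤ 3` adjacent groups of four overlap in one block.

Conversely, if `D(A)` is a product of five blocks, then `A - 1` is the product of the third and
fourth parameters. For `A = 2 + z E₀₁ + z² E₁₂` over the holomorphic functions on `ℂᵈ`, with `z` a
coordinate, comparing entries shows that this would make `z` invertible.
-/

open Matrix
open scoped Pointwise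

section AlternatingProduct

variable {M : Type*} [Monoid M]

/-- The set of products of `K` elements of `M` taken alternately from `S s` and `S (!s)`, starting
with `S s`. -/
def alternatingProduct (S : Bool → Set M) (s : Bool) (K : ℕ) : Set M :=
  (List.ofFn fun k : Fin K ↦ S (not^[k] s)).prod

theorem mem_alternatingProduct {S : Bool → Set M} {s : Bool} {K : ℕ} {a : M} :
    a ∈ alternatingProduct S s K ↔
      ∃ b : Fin K → M, (∀ k : Fin K, b k ∈ S (not^[k] s)) ∧ (List.ofFn b).prod = a :=
  Set.mem_prod_list_ofFn.trans
    ⟨fun ⟨b, hb⟩ ↦ ⟨fun k ↦ b k, fun k ↦ (b k).2, hb⟩,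
      fun ⟨b, hbS, hb⟩ ↦ ⟨fun k ↦ ⟨b k, hbS k⟩, hb⟩⟩

theorem alternatingProduct_zero (S : Bool → Set M) (s : Bool) : alternatingProduct S s 0 = 1 := rfl

theorem alternatingProduct_succ (S : Bool → Set M) (s : Bool) (K : ℕ) :
    alternatingProduct S s (K + 1) = S s * alternatingProduct S (!s) K := by
  rw [alternatingProduct, List.ofFn_succ, List.prod_cons]
  rfl

theorem alternatingProduct_one (S : Bool → Set M) (s : Bool) : alternatingProduct S s 1 = S s := by
  rw [alternatingProduct_succ, alternatingProduct_zero, mul_one]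

theorem alternatingProduct_add (S : Bool → Set M) (s : Bool) (K L : ℕ) :
    alternatingProduct S s (K + L) =
      alternatingProduct S s K * alternatingProduct S (not^[K] s) L := by
  induction K generalizing s with
  | zero => rw [alternatingProduct_zero, one_mul, zero_add, Function.iterate_zero_apply]
  | succ K ih =>
    rw [Nat.succ_add, alternatingProduct_succ, ih, alternatingProduct_succ, mul_assoc,
      Function.iterate_succ_apply]

theorem not_iterate_of_odd {L : ℕ} (hL : Odd L) : not^[L] = not :=
  Bool.involutive_not.iterate_odd hL

theorem alternatingProduct_subset_mul {S T : Bool → Set M} {L : ℕ} (hL : Odd L)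
    (h : ∀ s, T s ⊆ alternatingProduct S s L) (s : Bool) (K : ℕ) :
    alternatingProduct T s K ⊆ alternatingProduct S s (L * K) := by
  induction K generalizing s with
  | zero => rfl
  | succ K ih =>
    rw [alternatingProduct_succ, Nat.mul_succ, add_comm, alternatingProduct_add,
      not_iterate_of_odd hL]
    exact Set.mul_subset_mul (h s) (ih !s)

variable (U : Bool → Submonoid M)

theorem one_mem_alternatingProduct (s : Bool) (K : ℕ) :
    1 ∈ alternatingProduct (fun t ↦ (U t : Set M)) s K := by
  induction K generalizing s with
  | zero => rfl
  | succ K ih =>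
    rw [alternatingProduct_succ]
    exact Set.mem_mul.2 ⟨1, one_mem (U s), 1, ih !s, one_mul 1⟩

theorem alternatingProduct_mono (s : Bool) :
    Monotone (alternatingProduct (fun t ↦ (U t : Set M)) s) := by
  refine monotone_nat_of_le_succ fun K ↦ ?_
  rw [alternatingProduct_add]
  exact Set.subset_mul_left _ (one_mem_alternatingProduct U _ 1)

theorem coe_mul_alternatingProduct_succ (s : Bool) (K : ℕ) :
    (U s : Set M) * alternatingProduct (fun t ↦ U t) s (K + 1) =
      alternatingProduct (fun t ↦ U t) s (K + 1) := by
  rw [alternatingProduct_succ, ← mul_assoc, Submonoid.coe_mul_self_eq]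

theorem alternatingProduct_mul_alternatingProduct_iterate (s : Bool) (K L : ℕ) :
    alternatingProduct (fun t ↦ (U t : Set M)) s (K + 1) *
        alternatingProduct (fun t ↦ U t) (not^[K] s) (L + 1) =
      alternatingProduct (fun t ↦ U t) s (K + (L + 1)) := by
  rw [alternatingProduct_add _ s K 1, alternatingProduct_one, mul_assoc,
    coe_mul_alternatingProduct_succ, ← alternatingProduct_add]

theorem alternatingProduct_subset_mul_add_one {T : Bool → Set M} {L : ℕ} (hL : Odd L)
    (h : ∀ s, T s ⊆ alternatingProduct (fun t ↦ U t) s (L + 1)) (s : Bool) (K : ℕ) :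
    alternatingProduct T s K ⊆ alternatingProduct (fun t ↦ U t) s (L * K + 1) := by
  induction K generalizing s with
  | zero => exact Set.singleton_subset_iff.2 (one_mem_alternatingProduct U s 1)
  | succ K ih =>
    rw [alternatingProduct_succ, Nat.mul_succ, add_right_comm, add_comm,
      ← alternatingProduct_mul_alternatingProduct_iterate, not_iterate_of_odd hL]
    exact Set.mul_subset_mul (h s) (ih !s)

end AlternatingProduct

section SiegelFactors

variable {n R : Type*} [Fintype n] [DecidableEq n] [CommRing R]

/-- The elements of the two opposite Siegel unipotent groups when `Z` is symmetric: lower for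
`s = false`, upper for `s = true`. -/
def unipotentBlock : Bool → Matrix n n R → Matrix (n ⊕ n) (n ⊕ n) R
  | false, Z => fromBlocks 1 0 Z 1
  | true, Z => fromBlocks 1 Z 0 1

/-- The elements of the common Levi subgroup of the two Siegel parabolics when `Q` is invertible,
normalized so that `leviBlock s Q` has `Q` in the block where `unipotentBlock s Y` and
`unipotentBlock (!s) Z` multiply to `1 + Y * Z`. -/
noncomputable def leviBlock : Bool → Matrix n n R → Matrix (n ⊕ n) (n ⊕ n) R
  | false, Q => fromBlocks Q⁻¹ᵀ 0 0 Q
  | true, Q => fromBlocks Q 0 0 Q⁻¹ᵀ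

omit [Fintype n] in
theorem unipotentBlock_zero (s : Bool) :
    unipotentBlock s (0 : Matrix n n R) = 1 := by
  cases s <;> exact fromBlocks_one

theorem unipotentBlock_mul (s : Bool) (Y Z : Matrix n n R) :
    unipotentBlock s Y * unipotentBlock s Z = unipotentBlock s (Y + Z) := by
  cases s <;> simp [unipotentBlock, fromBlocks_multiply, add_comm]

theorem leviBlock_mul (s : Bool) (P Q : Matrix n n R) :
    leviBlock s P * leviBlock s Q = leviBlock s (P * Q) := by
  cases s <;> simp [leviBlock, fromBlocks_multiply, Matrix.mul_inv_rev]

theorem leviBlock_inv {Q : Matrix n n R} (hQ : IsUnit Q.det) (s : Bool) :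
    leviBlock s Q⁻¹ = leviBlock (!s) Qᵀ := by
  cases s <;> simp [leviBlock, nonsing_inv_nonsing_inv Q hQ, transpose_nonsing_inv]

/-- The unipotent radicals of the two opposite Siegel parabolics of the symplectic group. -/
def siegelUnipotent (n R : Type*) [Fintype n] [DecidableEq n] [CommRing R] (s : Bool) :
    Submonoid (Matrix (n ⊕ n) (n ⊕ n) R) where
  carrier := unipotentBlock s '' {Z | Z.IsSymm}
  one_mem' := ⟨0, isSymm_zero, unipotentBlock_zero s⟩
  mul_mem' := by
    rintro _ _ ⟨Y, hY, rfl⟩ ⟨Z, hZ, rfl⟩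
    exact ⟨Y + Z, IsSymm.add hY hZ, (unipotentBlock_mul s Y Z).symm⟩

/-- The products of `K` unitriangular factors for `Ω` over the ring `R`, starting with a lower
factor if `s = false`. -/
abbrev siegelProduct (n R : Type*) [Fintype n] [DecidableEq n] [CommRing R] :
    Bool → ℕ → Set (Matrix (n ⊕ n) (n ⊕ n) R) :=
  alternatingProduct fun t ↦ siegelUnipotent n R t

/-- `H` is a product of two symmetric matrices. Over a field every square matrix is; over a ring
this is a genuine condition. -/
def IsSymmProduct (H : Matrix n n R) : Prop :=
  ∃ Y Z : Matrix n n R, Y.IsSymm ∧ Z.IsSymm ∧ H = Y * Z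

omit [DecidableEq n] in
theorem IsSymmProduct.transpose {H : Matrix n n R} (hH : IsSymmProduct H) :
    IsSymmProduct Hᵀ := by
  obtain ⟨Y, Z, hY, hZ, rfl⟩ := hH
  exact ⟨Z, Y, hZ, hY, by rw [transpose_mul, hY.eq, hZ.eq]⟩

omit [DecidableEq n] in
theorem isSymm_mul_mul_transpose (P : Matrix n n R) {S : Matrix n n R} (hS : S.IsSymm) :
    (P * S * Pᵀ).IsSymm := by
  rw [IsSymm, transpose_mul, transpose_mul, transpose_transpose, hS.eq, Matrix.mul_assoc]

theorem unipotentBlock_mul_unipotentBlock_not {Q Y Z : Matrix n n R} (hY : Y.IsSymm)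
    (hZ : Z.IsSymm) (hYZ : Q = 1 + Y * Z) (hQ : IsUnit Q.det) (s : Bool) :
    unipotentBlock s Y * unipotentBlock (!s) Z =
      leviBlock s Q * unipotentBlock (!s) (Qᵀ * Z) * unipotentBlock s (Q⁻¹ * Y) := by
  have hQt : Qᵀ = 1 + Z * Y := by
    rw [hYZ, transpose_add, transpose_one, transpose_mul, hY.eq, hZ.eq]
  have hcomm : Qᵀ * Z = Z * Q := by rw [hQt, hYZ]; noncomm_ring
  have hQit : Q⁻¹ᵀ = 1 - Z * (Q⁻¹ * Y) := by
    rw [transpose_nonsing_inv]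
    refine inv_eq_right_inv ?_
    rw [mul_sub, ← Matrix.mul_assoc, hcomm, Matrix.mul_assoc, mul_nonsing_inv_cancel_left _ _ hQ,
      hQt, mul_one, add_sub_cancel_right]
  have hZ' : Q⁻¹ᵀ * (Qᵀ * Z) = Z := by
    rw [← Matrix.mul_assoc, ← transpose_mul, mul_nonsing_inv _ hQ, transpose_one, one_mul]
  have hone : Q⁻¹ᵀ + Z * (Q⁻¹ * Y) = 1 := by rw [hQit, sub_add_cancel]
  have hY' : Q * (Q⁻¹ * Y) = Y := mul_nonsing_inv_cancel_left _ _ hQ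
  cases s <;>
    simp [unipotentBlock, leviBlock, fromBlocks_multiply, hZ', hone, hY', ← hYZ,
      add_comm (Y * Z), add_comm (Z * (Q⁻¹ * Y))]

theorem unipotentBlock_mul_mem_siegelProduct_two {Y Z : Matrix n n R} (hY : Y.IsSymm)
    (hZ : Z.IsSymm) (s : Bool) :
    unipotentBlock s Y * unipotentBlock (!s) Z ∈ siegelProduct n R s 2 := by
  rw [siegelProduct, alternatingProduct_succ, alternatingProduct_one]
  exact Set.mul_mem_mul ⟨Y, hY, rfl⟩ ⟨Z, hZ, rfl⟩

theorem leviBlock_mem_siegelProduct_four {Q : Matrix n n R} (hQ : IsUnit Q.det)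
    (h : IsSymmProduct (Q - 1)) (s : Bool) : leviBlock s Q ∈ siegelProduct n R s 4 := by
  obtain ⟨Y, Z, hY, hZ, hYZ⟩ := h
  rw [sub_eq_iff_eq_add'] at hYZ
  have hQt : Qᵀ = 1 + Z * Y := by
    rw [hYZ, transpose_add, transpose_one, transpose_mul, hY.eq, hZ.eq]
  have hY' : (Q⁻¹ * Y).IsSymm := by
    have hYQt : Y * Qᵀ = Y + Y * Z * Yᵀ := by rw [hQt, hY.eq, mul_add, mul_one, mul_assoc]
    have hcongr : Q⁻¹ * Y = Q⁻¹ * (Y * Qᵀ) * Q⁻¹ᵀ := by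
      rw [mul_assoc, mul_assoc, ← transpose_mul, nonsing_inv_mul _ hQ, transpose_one, mul_one]
    rw [hcongr, hYQt]
    exact isSymm_mul_mul_transpose _ (hY.add (isSymm_mul_mul_transpose Y hZ))
  have hZ' : (Qᵀ * Z).IsSymm := by
    have hQtZ : Qᵀ * Z = Z + Z * Y * Zᵀ := by rw [hQt, hZ.eq, add_mul, one_mul]
    rw [hQtZ]
    exact hZ.add (isSymm_mul_mul_transpose Z hY)
  have key : leviBlock s Q = unipotentBlock s Y * unipotentBlock (!s) Z *
      (unipotentBlock s (-(Q⁻¹ * Y)) * unipotentBlock (!s) (-(Qᵀ * Z))) := by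
    rw [unipotentBlock_mul_unipotentBlock_not hY hZ hYZ hQ]
    simp only [mul_assoc]
    rw [← mul_assoc (unipotentBlock s _), unipotentBlock_mul, add_neg_cancel,
      unipotentBlock_zero, one_mul, unipotentBlock_mul, add_neg_cancel, unipotentBlock_zero,
      mul_one]
  rw [key, siegelProduct, alternatingProduct_add _ s 2 2]
  refine Set.mul_mem_mul (unipotentBlock_mul_mem_siegelProduct_two hY hZ s) ?_
  rw [show not^[2] s = s from Bool.not_not s]
  exact unipotentBlock_mul_mem_siegelProduct_two hY'.neg hZ'.neg s

end SiegelFactors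

section UnitSubdiagonal

variable {n k l : ℕ} {R : Type*} [CommRing R] {M N : Matrix (Fin n) (Fin n) R}

/-- `M` has ones on the `k`-th subdiagonal and zeros below it: upper unitriangular matrices are the
case `k = 0`, and upper Hessenberg matrices with ones on the subdiagonal are the case `k = 1`. -/
def HasUnitSubdiagonal (k : ℕ) (M : Matrix (Fin n) (Fin n) R) : Prop :=
  (∀ i j : Fin n, (i : ℕ) = j + k → M i j = 1) ∧ ∀ i j : Fin n, (j : ℕ) + k < i → M i j = 0

namespace HasUnitSubdiagonal

theorem one : HasUnitSubdiagonal 0 (1 : Matrix (Fin n) (Fin n) R) :=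
  ⟨fun _ _ h ↦ by rw [Fin.ext h, one_apply_eq], fun _ _ h ↦ one_apply_ne (Fin.ne_of_gt h)⟩

theorem mul (hM : HasUnitSubdiagonal k M) (hN : HasUnitSubdiagonal l N) :
    HasUnitSubdiagonal (k + l) (M * N) := by
  have hzero (i j t : Fin n) (h : (t : ℕ) + k < i ∨ (j : ℕ) + l < t) : M i t * N t j = 0 := by
    rcases h with h | h
    · rw [hM.2 i t h, zero_mul]
    · rw [hN.2 t j h, mul_zero]
  refine ⟨fun i j h ↦ ?_, fun i j h ↦ ?_⟩
  · rw [mul_apply, Finset.sum_eq_single (⟨j + l, by omega⟩ : Fin n), hM.1 _ _ (by grind),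
      hN.1 _ _ rfl, mul_one]
    · exact fun t _ ht ↦ hzero i j t (by grind)
    · simp
  · exact (mul_apply ..).trans (Finset.sum_eq_zero fun t _ ↦ hzero i j t (by omega))

theorem pow (hM : HasUnitSubdiagonal 1 M) (k : ℕ) : HasUnitSubdiagonal k (M ^ k) := by
  induction k with
  | zero => exact pow_zero M ▸ one
  | succ k ih => exact pow_succ M k ▸ ih.mul hM

theorem add (hM : HasUnitSubdiagonal k M) (hN : ∀ i j : Fin n, (j : ℕ) + k ≤ i → N i j = 0) :
    HasUnitSubdiagonal k (M + N) :=
  ⟨fun i j h ↦ by rw [Matrix.add_apply, hM.1 i j h, hN i j h.ge, add_zero],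
    fun i j h ↦ by rw [Matrix.add_apply, hM.2 i j h, hN i j h.le, add_zero]⟩

theorem det_eq_one (hM : HasUnitSubdiagonal 0 M) : M.det = 1 := by
  rw [det_of_isUpperTriangular hM.2]
  exact Finset.prod_eq_one fun i _ ↦ hM.1 i i rfl

theorem isUnit_det (hM : HasUnitSubdiagonal 0 M) : IsUnit M.det := hM.det_eq_one ▸ isUnit_one

theorem inv (hM : HasUnitSubdiagonal 0 M) : HasUnitSubdiagonal 0 M⁻¹ := by
  let := invertibleOfIsUnitDet M hM.isUnit_det
  have htri : M⁻¹.IsUpperTriangular := blockTriangular_inv_of_blockTriangular hM.2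
  refine ⟨fun i j h ↦ ?_, fun _ _ h ↦ htri h⟩
  obtain rfl := Fin.ext h
  have hii : (M * M⁻¹) i i = 1 := by rw [mul_nonsing_inv _ hM.isUnit_det, one_apply_eq]
  rwa [mul_apply, Finset.sum_eq_single i, hM.1 i i rfl, one_mul] at hii
  · intro j _ hj
    rcases lt_or_gt_of_ne hj with hj | hj
    · rw [hM.2 i j hj, zero_mul]
    · rw [htri hj, mul_zero]
  · simp

end HasUnitSubdiagonal

/-- The nilpotent matrix with ones on the subdiagonal. -/
def subdiagonalShift (n : ℕ) (R : Type*) [CommRing R] : Matrix (Fin n) (Fin n) R :=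
  of fun i j ↦ if (i : ℕ) = j + 1 then 1 else 0

theorem hasUnitSubdiagonal_subdiagonalShift : HasUnitSubdiagonal 1 (subdiagonalShift n R) :=
  ⟨fun _ _ h ↦ if_pos h, fun _ _ h ↦ if_neg (by omega)⟩

theorem det_one_add_subdiagonalShift : (1 + subdiagonalShift n R).det = 1 := by
  rw [det_of_isLowerTriangular]
  · simp [subdiagonalShift]
  · intro i j (hij : i < j)
    rw [Matrix.add_apply, one_apply_ne hij.ne, zero_add, subdiagonalShift, of_apply,
      if_neg (by omega)]

theorem HasUnitSubdiagonal.mul_one_add_subdiagonalShift_sub_one (hM : HasUnitSubdiagonal 0 M) :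
    HasUnitSubdiagonal 1 (M * (1 + subdiagonalShift n R) - 1) := by
  rw [mul_add, mul_one, add_comm, add_sub_assoc]
  refine (zero_add 1 ▸ hM.mul hasUnitSubdiagonal_subdiagonalShift).add fun i j h ↦ ?_
  rw [Matrix.sub_apply, hM.2 i j (by omega), one_apply_ne (by omega), sub_zero]

end UnitSubdiagonal

section Krylov

variable {m : ℕ} {R : Type*} [CommRing R] {H : Matrix (Fin (m + 1)) (Fin (m + 1)) R}

/-- The Krylov matrix with columns `e, H e, H² e, …` for the first basis vector `e`. -/
def krylovColumns (H : Matrix (Fin (m + 1)) (Fin (m + 1)) R) :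
    Matrix (Fin (m + 1)) (Fin (m + 1)) R := of fun i j ↦ (H ^ (j : ℕ)) i 0

/-- The Krylov matrix with rows `eᵀ, eᵀ H, eᵀ H², …` for the last basis vector `e`. -/
def krylovRows (H : Matrix (Fin (m + 1)) (Fin (m + 1)) R) :
    Matrix (Fin (m + 1)) (Fin (m + 1)) R := of fun i j ↦ (H ^ (i : ℕ)) (Fin.last m) j

theorem isUnit_det_krylovColumns (hH : HasUnitSubdiagonal 1 H) : IsUnit (krylovColumns H).det :=
  HasUnitSubdiagonal.isUnit_det
    ⟨fun i j h ↦ (hH.pow j).1 i 0 (by simpa using h),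
      fun i j h ↦ (hH.pow j).2 i 0 (by simpa using h)⟩

theorem isUnit_det_krylovRows (hH : HasUnitSubdiagonal 1 H) : IsUnit (krylovRows H).det := by
  have hrev : HasUnitSubdiagonal 0 ((krylovRows H).submatrix Fin.revPerm id) :=
    ⟨fun i j h ↦ (hH.pow _).1 _ j (by simp [Fin.val_rev]; omega),
      fun i j h ↦ (hH.pow _).2 _ j (by simp [Fin.val_rev]; omega)⟩
  have hdet := hrev.isUnit_det
  rw [det_permute] at hdet
  exact isUnit_of_mul_isUnit_right hdet

theorem isSymm_krylovRows_mul_pow_mul_krylovColumns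
    (H : Matrix (Fin (m + 1)) (Fin (m + 1)) R) (k : ℕ) :
    (krylovRows H * H ^ k * krylovColumns H).IsSymm := by
  have hankel (i j) : (krylovRows H * H ^ k * krylovColumns H) i j =
      (H ^ (i + k + j : ℕ)) (Fin.last m) 0 := by
    rw [pow_add, pow_add, mul_apply, mul_apply]
    rfl
  ext i j
  rw [transpose_apply, hankel, hankel, add_right_comm, add_comm (j : ℕ), add_right_comm]

end Krylov

section SymmProduct

variable {R : Type*} [CommRing R]

theorem isSymmProduct_of_isSymm_mul {n : Type*} [Fintype n] [DecidableEq n] {H P Q : Matrix n n R}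
    (hP : IsUnit P.det) (hQ : IsUnit Q.det) (hQP : (Q * P).IsSymm) (hQHP : (Q * H * P).IsSymm) :
    IsSymmProduct H := by
  refine ⟨P * (Q * P)⁻¹ * Pᵀ, P⁻¹ᵀ * (Q * H * P) * P⁻¹, isSymm_mul_mul_transpose P hQP.inv, ?_, ?_⟩
  · simpa only [transpose_transpose] using isSymm_mul_mul_transpose P⁻¹ᵀ hQHP
  · have hPt : Pᵀ * P⁻¹ᵀ = 1 := by rw [← transpose_mul, nonsing_inv_mul _ hP, transpose_one]
    rw [Matrix.mul_inv_rev, mul_nonsing_inv_cancel_left _ _ hP, mul_assoc, ← mul_assoc Pᵀ,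
      ← mul_assoc Pᵀ, hPt, one_mul, mul_nonsing_inv_cancel_right _ _ hP,
      nonsing_inv_mul_cancel_left _ _ hQ]

theorem HasUnitSubdiagonal.isSymmProduct {n : ℕ} {H : Matrix (Fin n) (Fin n) R}
    (hH : HasUnitSubdiagonal 1 H) : IsSymmProduct H := by
  obtain _ | m := n
  · exact ⟨0, 0, isSymm_zero, isSymm_zero, Subsingleton.elim _ _⟩
  · refine isSymmProduct_of_isSymm_mul (isUnit_det_krylovColumns hH)
      (isUnit_det_krylovRows hH) ?_ ?_
    · simpa only [pow_zero, mul_one] using isSymm_krylovRows_mul_pow_mul_krylovColumns H 0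
    · simpa only [pow_one] using isSymm_krylovRows_mul_pow_mul_krylovColumns H 1

theorem HasUnitSubdiagonal.leviBlock_mem_siegelProduct_seven {n : ℕ}
    {A : Matrix (Fin n) (Fin n) R} (hA : HasUnitSubdiagonal 0 A) (s : Bool) :
    leviBlock s A ∈ siegelProduct (Fin n) R s 7 := by
  set C := 1 + subdiagonalShift n R with hC
  have hCdet : IsUnit C.det := det_one_add_subdiagonalShift (R := R) ▸ isUnit_one
  have hAC : leviBlock s (A * C) ∈ siegelProduct (Fin n) R s 4 :=
    leviBlock_mem_siegelProduct_four (det_mul A C ▸ hA.isUnit_det.mul hCdet)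
      hA.mul_one_add_subdiagonalShift_sub_one.isSymmProduct s
  have hCinv : leviBlock s C⁻¹ ∈ siegelProduct (Fin n) R (!s) 4 := by
    rw [leviBlock_inv hCdet]
    refine leviBlock_mem_siegelProduct_four (det_transpose C ▸ hCdet) ?_ _
    rw [← transpose_one, ← transpose_sub, hC, add_sub_cancel_left]
    exact hasUnitSubdiagonal_subdiagonalShift.isSymmProduct.transpose
  rw [← mul_nonsing_inv_cancel_right _ A hCdet, ← leviBlock_mul, siegelProduct,
    ← alternatingProduct_mul_alternatingProduct_iterate _ s 3 3,
    not_iterate_of_odd (by decide)]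
  exact Set.mul_mem_mul hAC hCinv

theorem HasUnitSubdiagonal.isSymmProduct_sub_one {n : ℕ} (hn : n ≤ 3)
    {A : Matrix (Fin n) (Fin n) R} (hA : HasUnitSubdiagonal 0 A) : IsSymmProduct (A - 1) := by
  have hdiag i : A i i = 1 := hA.1 i i rfl
  have hlow i j (h : j < i) : A i j = 0 := hA.2 i j h
  interval_cases n
  · exact ⟨0, 0, isSymm_zero, isSymm_zero, Subsingleton.elim _ _⟩
  · refine ⟨0, 0, isSymm_zero, isSymm_zero, ?_⟩
    ext i j
    simp [Subsingleton.elim i j, hdiag]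
  · refine ⟨!![A 0 1, 0; 0, 0], !![0, 1; 1, 0],
      IsSymm.ext fun i j ↦ by fin_cases i <;> fin_cases j <;> rfl,
      IsSymm.ext fun i j ↦ by fin_cases i <;> fin_cases j <;> rfl, ?_⟩
    ext i j; fin_cases i <;> fin_cases j <;> simp [hdiag, hlow]
  · refine ⟨!![0, 1, 0; 1, 0, 0; 0, 0, 0], !![0, 0, A 1 2; 0, A 0 1, A 0 2; A 1 2, A 0 2, 0],
      IsSymm.ext fun i j ↦ by fin_cases i <;> fin_cases j <;> rfl,
      IsSymm.ext fun i j ↦ by fin_cases i <;> fin_cases j <;> rfl, ?_⟩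
    ext i j
    fin_cases i <;> fin_cases j <;> simp [mul_apply, Fin.sum_univ_three, hdiag, hlow]

end SymmProduct

section UnitriangularSymplectic

variable {n : ℕ} {R : Type*} [CommRing R]

/-- The matrices `M⁻(A, Z)` over the ring `R` if `s = false`, and `M⁺(A⁻¹, Z)` if `s = true`. -/
def unitriangularSymplectic (n : ℕ) (R : Type*) [CommRing R] (s : Bool) :
    Set (Matrix (Fin n ⊕ Fin n) (Fin n ⊕ Fin n) R) :=
  (siegelUnipotent (Fin n) R s : Set _) * leviBlock s '' {A | HasUnitSubdiagonal 0 A}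

theorem unitriangularSymplectic_subset {s : Bool} {L : ℕ}
    (h : ∀ A : Matrix (Fin n) (Fin n) R, HasUnitSubdiagonal 0 A →
      leviBlock s A ∈ siegelProduct (Fin n) R s (L + 1)) :
    unitriangularSymplectic n R s ⊆ siegelProduct (Fin n) R s (L + 1) := by
  rw [siegelProduct, ← coe_mul_alternatingProduct_succ, unitriangularSymplectic]
  exact Set.mul_subset_mul_left (Set.image_subset_iff.2 h)

theorem alternatingProduct_unitriangularSymplectic_subset_seven (s : Bool) (K : ℕ) :
    alternatingProduct (unitriangularSymplectic n R) s K ⊆ siegelProduct (Fin n) R s (7 * K) :=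
  alternatingProduct_subset_mul (by decide) (fun t ↦ unitriangularSymplectic_subset
    fun _ hA ↦ hA.leviBlock_mem_siegelProduct_seven t) s K

theorem alternatingProduct_unitriangularSymplectic_subset_four (hn : n ≤ 3) (s : Bool) (K : ℕ) :
    alternatingProduct (unitriangularSymplectic n R) s K ⊆ siegelProduct (Fin n) R s (4 * K) := by
  obtain rfl | hK := K.eq_zero_or_pos
  · rfl
  have hmerge : alternatingProduct (unitriangularSymplectic n R) s K ⊆
      siegelProduct (Fin n) R s (3 * K + 1) :=
    alternatingProduct_subset_mul_add_one _ (by decide) (fun t ↦ unitriangularSymplectic_subset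
      fun _ hA ↦ leviBlock_mem_siegelProduct_four hA.isUnit_det (hA.isSymmProduct_sub_one hn) t)
      s K
  exact hmerge.trans (alternatingProduct_mono _ s (by omega))

end UnitriangularSymplectic

section BaseChange

variable {n R S : Type*} [Fintype n] [DecidableEq n] [CommRing R] [CommRing S]

omit [Fintype n] in
theorem map_unipotentBlock (f : R →+* S) (s : Bool) (Z : Matrix n n R) :
    (unipotentBlock s Z).map f = unipotentBlock s (Z.map f) := by
  cases s <;> simp [unipotentBlock, fromBlocks_map]

theorem map_inv_of_isUnit_det (f : R →+* S) {Q : Matrix n n R} (hQ : IsUnit Q.det) :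
    Q⁻¹.map f = (Q.map f)⁻¹ := by
  refine (inv_eq_right_inv ?_).symm
  rw [← Matrix.map_mul, mul_nonsing_inv _ hQ, Matrix.map_one f f.map_zero f.map_one]

theorem map_leviBlock (f : R →+* S) {Q : Matrix n n R} (hQ : IsUnit Q.det) (s : Bool) :
    (leviBlock s Q).map f = leviBlock s (Q.map f) := by
  cases s <;> simp [leviBlock, fromBlocks_map, transpose_map, ← map_inv_of_isUnit_det f hQ]

theorem map_prod_ofFn (f : R →+* S) {K : ℕ} (M : Fin K → Matrix n n R) :
    (List.ofFn M).prod.map f = (List.ofFn fun k ↦ (M k).map f).prod := by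
  rw [← RingHom.mapMatrix_apply, map_list_prod, List.map_ofFn]
  rfl

end BaseChange

namespace ReducedComplexStructure

variable {X : Type*} [TopologicalSpace X] {𝒪 : ReducedComplexStructure X} {l m : Type*}

theorem hol_const (c : ℂ) : 𝒪.Hol fun _ ↦ c := by
  intro x
  obtain ⟨N, U, φ, W, hx, hφ, -⟩ := 𝒪.exists_chart x
  exact (hφ.2.2 x hx _).2 ⟨fun _ ↦ c, analyticAt_const, .rfl⟩

theorem Hol.add {f g : X → ℂ} (hf : 𝒪.Hol f) (hg : 𝒪.Hol g) : 𝒪.Hol (f + g) := by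
  intro x
  obtain ⟨N, U, φ, W, hx, hφ, -⟩ := 𝒪.exists_chart x
  obtain ⟨F, hF, hfF⟩ := (hφ.2.2 x hx f).1 (hf x)
  obtain ⟨G, hG, hgG⟩ := (hφ.2.2 x hx g).1 (hg x)
  exact (hφ.2.2 x hx _).2 ⟨F + G, hF.add hG, hfF.add hgG⟩

theorem Hol.mul {f g : X → ℂ} (hf : 𝒪.Hol f) (hg : 𝒪.Hol g) : 𝒪.Hol (f * g) := by
  intro x
  obtain ⟨N, U, φ, W, hx, hφ, -⟩ := 𝒪.exists_chart x
  obtain ⟨F, hF, hfF⟩ := (hφ.2.2 x hx f).1 (hf x)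
  obtain ⟨G, hG, hgG⟩ := (hφ.2.2 x hx g).1 (hg x)
  exact (hφ.2.2 x hx _).2 ⟨F * G, hF.mul hG, hfF.mul hgG⟩

variable (𝒪) in
/-- The algebra of holomorphic functions on `X`. -/
def holAlgebra : Subalgebra ℂ (X → ℂ) where
  carrier := {f | 𝒪.Hol f}
  mul_mem' := Hol.mul
  add_mem' := Hol.add
  algebraMap_mem' := hol_const

variable (𝒪) in
/-- Evaluation of holomorphic functions at the point `x`. -/
def eval (x : X) : 𝒪.holAlgebra →+* ℂ := (Pi.evalRingHom _ x).comp 𝒪.holAlgebra.subtype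

theorem matrix_ext_eval {M N : Matrix l m 𝒪.holAlgebra}
    (h : ∀ x, M.map (𝒪.eval x) = N.map (𝒪.eval x)) : M = N :=
  Matrix.ext fun i j ↦ Subtype.ext (funext fun x ↦ congr_fun₂ (h x) i j)

theorem holMatrix_map_eval (M : Matrix l m 𝒪.holAlgebra) :
    𝒪.HolMatrix fun x ↦ M.map (𝒪.eval x) :=
  fun i j ↦ (M i j).2

theorem HolMatrix.exists_map_eval_eq {F : X → Matrix l m ℂ} (hF : 𝒪.HolMatrix F) :
    ∃ M : Matrix l m 𝒪.holAlgebra, ∀ x, M.map (𝒪.eval x) = F x :=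
  ⟨of fun i j ↦ ⟨fun x ↦ F x i j, hF i j⟩, fun _ ↦ rfl⟩

theorem isSymm_of_isSymm_map_eval {M : Matrix l l 𝒪.holAlgebra}
    (h : ∀ x, (M.map (𝒪.eval x)).IsSymm) : M.IsSymm :=
  matrix_ext_eval h

theorem hasUnitSubdiagonal_of_map_eval {n k : ℕ} {M : Matrix (Fin n) (Fin n) 𝒪.holAlgebra}
    (h : ∀ x, HasUnitSubdiagonal k (M.map (𝒪.eval x))) : HasUnitSubdiagonal k M :=
  ⟨fun i j hij ↦ Subtype.ext (funext fun x ↦ (h x).1 i j hij),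
    fun i j hij ↦ Subtype.ext (funext fun x ↦ (h x).2 i j hij)⟩

end ReducedComplexStructure

theorem IsUpperUnitriangular.hasUnitSubdiagonal {n : ℕ} {A : Matrix (Fin n) (Fin n) ℂ}
    (hA : IsUpperUnitriangular A) : HasUnitSubdiagonal 0 A :=
  ⟨fun _ _ h ↦ Fin.ext h ▸ hA.1 _, hA.2⟩

section Factorizations

variable {n K : ℕ} {X : Type*} [TopologicalSpace X] {𝒪 : ReducedComplexStructure X}
  {f : X → Matrix (Fin n ⊕ Fin n) (Fin n ⊕ Fin n) ℂ}

theorem unipotentBlock_not_iterate_false (k : ℕ) (Z : Matrix (Fin n) (Fin n) ℂ) :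
    unipotentBlock (not^[k] false) Z = if Even k then Mminus Z else Mplus Z := by
  split_ifs with hk
  · rw [Bool.involutive_not.iterate_even hk]
    rfl
  · rw [not_iterate_of_odd (Nat.not_even_iff_odd.1 hk)]
    rfl

theorem unipotentBlock_mul_leviBlock_not_iterate_false (k : ℕ) {A : Matrix (Fin n) (Fin n) ℂ}
    (hA : IsUnit A.det) (Z : Matrix (Fin n) (Fin n) ℂ) :
    unipotentBlock (not^[k] false) Z * leviBlock (not^[k] false) (if Even k then A else A⁻¹) =
      if Even k then MminusTilde A Z else MplusTilde A Z := by
  split_ifs with hk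
  · rw [Bool.involutive_not.iterate_even hk]
    rfl
  · rw [not_iterate_of_odd (Nat.not_even_iff_odd.1 hk), Bool.not_false, leviBlock,
      nonsing_inv_nonsing_inv A hA]
    rfl

theorem factorsOmega_iff : FactorsOmega 𝒪 f K ↔
    ∃ F ∈ siegelProduct (Fin n) 𝒪.holAlgebra false K, ∀ x, F.map (𝒪.eval x) = f x := by
  simp only [FactorsOmega, ← unipotentBlock_not_iterate_false, siegelProduct,
    mem_alternatingProduct]
  constructor
  · rintro ⟨Z, hZ, hZs, hf⟩
    choose M hM using fun k ↦ (hZ k).exists_map_eval_eq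
    refine ⟨_, ⟨fun k ↦ unipotentBlock (not^[k] false) (M k), fun k ↦ ⟨M k, ?_, rfl⟩, rfl⟩,
      fun x ↦ ?_⟩
    · exact 𝒪.isSymm_of_isSymm_map_eval fun x ↦ hM k x ▸ hZs k x
    · simp only [map_prod_ofFn, map_unipotentBlock, hM, hf]
  · rintro ⟨_, ⟨b, hb, rfl⟩, hf⟩
    choose M hM hb using hb
    refine ⟨fun k x ↦ (M k).map (𝒪.eval x), fun k ↦ 𝒪.holMatrix_map_eval (M k),
      fun k x ↦ (hM k).map _, fun x ↦ ?_⟩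
    simp only [← hf, map_prod_ofFn, ← hb, map_unipotentBlock]

theorem FactorsOmegaTilde.exists_mem_alternatingProduct (h : FactorsOmegaTilde 𝒪 f K) :
    ∃ F ∈ alternatingProduct (unitriangularSymplectic n 𝒪.holAlgebra) false K,
      ∀ x, F.map (𝒪.eval x) = f x := by
  obtain ⟨A, Z, hA, hAu, hZ, hZs, hf⟩ := h
  choose B hB using fun k ↦ (hA k).exists_map_eval_eq
  choose M hM using fun k ↦ (hZ k).exists_map_eval_eq
  have hBu (k) : HasUnitSubdiagonal 0 (B k) := 𝒪.hasUnitSubdiagonal_of_map_eval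
    fun x ↦ hB k x ▸ (hAu k x).hasUnitSubdiagonal
  have hBu' (k : Fin K) : HasUnitSubdiagonal 0 (if Even (k : ℕ) then B k else (B k)⁻¹) := by
    split_ifs
    exacts [hBu k, (hBu k).inv]
  have hM_symm (k) : (M k).IsSymm :=
    𝒪.isSymm_of_isSymm_map_eval fun x ↦ hM k x ▸ hZs k x
  refine ⟨_, mem_alternatingProduct.2 ⟨fun k ↦ unipotentBlock (not^[k] false) (M k) *
    leviBlock (not^[k] false) (if Even (k : ℕ) then B k else (B k)⁻¹),
    fun k ↦ Set.mul_mem_mul ⟨M k, hM_symm k, rfl⟩ ⟨_, hBu' k, rfl⟩, rfl⟩, fun x ↦ ?_⟩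
  have hmap (k : Fin K) : (if Even (k : ℕ) then B k else (B k)⁻¹).map (𝒪.eval x) =
      if Even (k : ℕ) then A k x else (A k x)⁻¹ := by
    split_ifs
    exacts [hB k x, by rw [map_inv_of_isUnit_det _ (hBu k).isUnit_det, hB]]
  rw [hf, map_prod_ofFn]
  congr! 3 with k
  rw [← unipotentBlock_mul_leviBlock_not_iterate_false _ (hAu k x).hasUnitSubdiagonal.isUnit_det,
    Matrix.map_mul, map_unipotentBlock, map_leviBlock _ (hBu' k).isUnit_det, hM, hmap]

theorem FactorsOmegaTilde.factorsOmega_mul {c : ℕ}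
    (hc : alternatingProduct (unitriangularSymplectic n 𝒪.holAlgebra) false K ⊆
      siegelProduct (Fin n) 𝒪.holAlgebra false (c * K)) (h : FactorsOmegaTilde 𝒪 f K) :
    FactorsOmega 𝒪 f (c * K) := by
  obtain ⟨F, hF, hf⟩ := h.exists_mem_alternatingProduct
  exact factorsOmega_iff.2 ⟨F, hc hF, hf⟩

end Factorizations

theorem ksymp_le_mul_ksympTilde {n d c : ℕ} (hc : c ≠ 0)
    (h : ∀ K, SufficesOmegaTilde n d K → SufficesOmega n d (c * K)) :
    Ksymp n d ≤ c * KsympTilde n d := by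
  simp only [KsympTilde, ENat.mul_iInf_of_ne (Nat.cast_ne_zero.2 hc)]
  exact le_iInf₂ fun K hK ↦ Nat.cast_mul (α := ℕ∞) c K ▸ iInf₂_le (c * K) (h K hK)

section AffineSpace

open ReducedComplexStructure

variable {d : ℕ}

theorem isHolChart_analyticAt_id :
    IsHolChart (fun f x ↦ AnalyticAt ℂ f x) Set.univ (id : (Fin d → ℂ) → (Fin d → ℂ)) := by
  refine ⟨isOpen_univ, (Homeomorph.Set.univ (Fin d → ℂ)).isEmbedding, fun y _ f ↦
    ⟨fun h ↦ ⟨f, h, .rfl⟩, ?_⟩⟩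
  rintro ⟨g, hg, hfg⟩
  exact hg.congr hfg.symm

/-- The standard complex structure of `ℂᵈ`. -/
def affineSpace (d : ℕ) : ReducedComplexStructure (Fin d → ℂ) where
  HolAt f x := AnalyticAt ℂ f x
  exists_chart x := ⟨d, Set.univ, id, Set.univ, Set.mem_univ x, isHolChart_analyticAt_id,
    isOpen_univ, Set.subset_univ _, fun z _ ↦ ⟨Set.univ, isOpen_univ, Set.mem_univ z,
      Set.subset_univ _, 0, Fin.elim0, fun i ↦ i.elim0, by simp⟩⟩

theorem hol_affineSpace_apply (i : Fin d) : (affineSpace d).Hol fun x ↦ x i := fun x ↦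
  (ContinuousLinearMap.proj (R := ℂ) (φ := fun _ : Fin d ↦ ℂ) i).analyticAt x

theorem continuous_of_hol_affineSpace {f : (Fin d → ℂ) → ℂ} (hf : (affineSpace d).Hol f) :
    Continuous f := continuous_iff_continuousAt.2 fun x ↦ (hf x).continuousAt

theorem isClosed_hull_affineSpace (K : Set (Fin d → ℂ)) : IsClosed ((affineSpace d).hull K) := by
  simp only [hull, Set.ofPred_forall]
  exact isClosed_iInter fun f ↦ isClosed_iInter fun hf ↦ isClosed_iInter fun C ↦
    isClosed_iInter fun _ ↦ isClosed_le (continuous_of_hol_affineSpace hf).norm continuous_const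

theorem isBounded_hull_affineSpace {K : Set (Fin d → ℂ)} (hK : Bornology.IsBounded K) :
    Bornology.IsBounded ((affineSpace d).hull K) := by
  obtain ⟨C, hC⟩ := hK.exists_norm_le
  refine isBounded_iff_forall_norm_le.2 ⟨max C 0, fun x hx ↦ ?_⟩
  refine (pi_norm_le_iff_of_nonneg (le_max_right _ _)).2 fun i ↦ ?_
  exact hx _ (hol_affineSpace_apply i) _ fun y hy ↦
    (norm_le_pi_norm y i).trans ((hC y hy).trans (le_max_left _ _))

theorem isStein_affineSpace : (affineSpace d).IsStein where
  t2 := inferInstance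
  secondCountable := inferInstance
  convex K hK := Metric.isCompact_of_isClosed_isBounded (isClosed_hull_affineSpace K)
    (isBounded_hull_affineSpace hK.isBounded)
  separable _ _ hxy :=
    have ⟨i, hi⟩ := Function.ne_iff.1 hxy
    ⟨_, hol_affineSpace_apply i, hi⟩

theorem finrank_le_of_eventually_rightInverse {𝕜 E F : Type*} [NontriviallyNormedField 𝕜]
    [NormedAddCommGroup E] [NormedSpace 𝕜 E] [FiniteDimensional 𝕜 E] [NormedAddCommGroup F]
    [NormedSpace 𝕜 F] {φ : E → F} {g : F → E} {w : F} (hg : DifferentiableAt 𝕜 g w)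
    (hφ : DifferentiableAt 𝕜 φ (g w)) (h : ∀ᶠ y in nhds w, φ (g y) = y) :
    Module.finrank 𝕜 F ≤ Module.finrank 𝕜 E := by
  have hid : (fderiv 𝕜 φ (g w)).comp (fderiv 𝕜 g w) = .id 𝕜 F :=
    (hφ.hasFDerivAt.comp w hg.hasFDerivAt).unique ((hasFDerivAt_id w).congr_of_eventuallyEq h)
  have hsurj : Function.Surjective (fderiv 𝕜 φ (g w)) := fun v ↦ ⟨_, DFunLike.congr_fun hid v⟩
  exact LinearMap.finrank_le_finrank_of_surjective (f := (fderiv 𝕜 φ (g w)).toLinearMap) hsurj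

theorem IsHolChart.nhds_le_map {X : Type*} [TopologicalSpace X] {HolAt : (X → ℂ) → X → Prop}
    {N : ℕ} {U : Set X} {φ : X → (Fin N → ℂ)} (h : IsHolChart HolAt U φ) (hφ : IsOpen (φ '' U))
    {x : X} (hx : x ∈ U) : nhds (φ x) ≤ Filter.map φ (nhds x) := by
  have hopen : Topology.IsOpenEmbedding (U.domRestrict φ) :=
    ⟨h.2.1, by rwa [Set.range_domRestrict]⟩
  rw [show φ x = U.domRestrict φ ⟨x, hx⟩ from rfl, ← hopen.map_nhds_eq,
    show U.domRestrict φ = φ ∘ Subtype.val from rfl, ← Filter.map_map]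
  exact Filter.map_mono continuous_subtype_val.continuousAt

theorem le_of_isRegularPoint_affineSpace {x : Fin d → ℂ} {k : ℕ}
    (h : (affineSpace d).IsRegularPoint x k) : k ≤ d := by
  obtain ⟨U, φ, hx, hU, hopen⟩ := h
  have hφ : AnalyticAt ℂ φ x := AnalyticAt.pi fun i ↦ (hU.2.2 x hx fun y ↦ φ y i).2
    ⟨fun z ↦ z i, hol_affineSpace_apply i _, .rfl⟩
  choose g hg hgφ using fun i ↦ (hU.2.2 x hx fun y ↦ y i).1 (hol_affineSpace_apply i x)
  have hleft : ∀ᶠ y in nhds x, (fun i ↦ g i (φ y)) = y := by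
    filter_upwards [Filter.eventually_all.2 hgφ] with y hy
    exact funext fun i ↦ (hy i).symm
  have hright : ∀ᶠ w in nhds (φ x), φ (fun i ↦ g i w) = w :=
    hU.nhds_le_map hopen hx (hleft.mono fun y hy ↦ congr_arg φ hy)
  simpa using finrank_le_of_eventually_rightInverse (𝕜 := ℂ) (AnalyticAt.pi hg).differentiableAt
    (hleft.self_of_nhds.symm ▸ hφ.differentiableAt) hright

theorem hasDim_affineSpace : (affineSpace d).HasDim d :=
  ⟨⟨0, Set.univ, id, Set.mem_univ _, isHolChart_analyticAt_id, by simp⟩,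
    fun _ ⟨_, hx⟩ ↦ le_of_isRegularPoint_affineSpace hx⟩

end AffineSpace

section LowerBound

theorem isSymmProduct_sub_one_of_leviBlock_mem_siegelProduct_five {n R : Type*} [Fintype n]
    [DecidableEq n] [CommRing R] {Q : Matrix n n R} {s : Bool}
    (h : leviBlock s Q ∈ siegelProduct n R s 5) : IsSymmProduct (Q - 1) := by
  simp only [siegelProduct, alternatingProduct_succ, alternatingProduct_zero, mul_one,
    Bool.not_not, Set.mem_mul] at h
  obtain ⟨_, ⟨Z₁, -, rfl⟩, _, ⟨_, ⟨Z₂, -, rfl⟩, _, ⟨_, ⟨Z₃, hZ₃, rfl⟩, _, ⟨_, ⟨Z₄, hZ₄, rfl⟩, _,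
    ⟨Z₅, -, rfl⟩, rfl⟩, rfl⟩, rfl⟩, h⟩ := h
  refine ⟨Z₃, Z₄, hZ₃, hZ₄, sub_eq_iff_eq_add.2 ?_⟩
  have hinner : unipotentBlock s (-Z₁) * leviBlock s Q * unipotentBlock s (-Z₅) =
      unipotentBlock (!s) Z₂ * unipotentBlock s Z₃ * unipotentBlock (!s) Z₄ := by
    have hcancel (Z : Matrix n n R) : unipotentBlock s Z * unipotentBlock s (-Z) = 1 := by
      rw [unipotentBlock_mul, add_neg_cancel, unipotentBlock_zero]
    have hcancel' (Z : Matrix n n R) : unipotentBlock s (-Z) * unipotentBlock s Z = 1 := by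
      rw [unipotentBlock_mul, neg_add_cancel, unipotentBlock_zero]
    rw [← h]
    simp only [mul_assoc, hcancel, mul_one]
    rw [← mul_assoc, hcancel', one_mul]
  cases s
  · simpa [unipotentBlock, leviBlock, fromBlocks_multiply] using congr_arg toBlocks₂₂ hinner
  · simpa [unipotentBlock, leviBlock, fromBlocks_multiply, add_comm] using
      congr_arg toBlocks₁₁ hinner

theorem leviBlock_mem_symplecticGroup {n R : Type*} [Fintype n]
    [DecidableEq n] [CommRing R] {Q : Matrix n n R} (hQ : IsUnit Q.det) (s : Bool) :
    leviBlock s Q ∈ symplecticGroup n R := by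
  have h₁ : Q⁻¹ * Q = 1 := nonsing_inv_mul _ hQ
  have h₂ : Qᵀ * Q⁻¹ᵀ = 1 := by rw [← transpose_mul, h₁, transpose_one]
  cases s <;> simp [leviBlock, SymplecticGroup.fromBlocks_mem_iff, h₁, h₂]

section Obstruction

variable {n R : Type*} [Fintype n] [DecidableEq n] [CommRing R] {i j k : n} {z : R}
  {Y W : Matrix n n R}

/-- For distinct `i j k`, the nilpotent matrix with entries `z` at `(i, j)` and `z²` at `(j, k)`.
With both entries `z` there would be no obstruction: `1` plus the matrix would be a product of two
symmetric matrices. -/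
def weightedChain (i j k : n) (z : R) : Matrix n n R := single i j z + single j k (z ^ 2)

theorem isNilpotent_weightedChain (hij : i ≠ j) (hik : i ≠ k) (hjk : j ≠ k) :
    IsNilpotent (weightedChain i j k z) := by
  refine ⟨3, ?_⟩
  simp [weightedChain, pow_succ, add_mul, mul_add, hij.symm, hik.symm, hjk.symm]

theorem weightedChain_mul_apply_first (hij : i ≠ j) (t : n) :
    (weightedChain i j k z * Y) i t = z * Y j t := by
  simp [weightedChain, add_mul, hij]

theorem weightedChain_mul_apply_second (hij : i ≠ j) (t : n) :
    (weightedChain i j k z * Y) j t = z ^ 2 * Y k t := by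
  simp [weightedChain, add_mul, hij.symm]

theorem weightedChain_mul_apply_of_ne {l : n} (hi : l ≠ i) (hj : l ≠ j) (t : n) :
    (weightedChain i j k z * Y) l t = 0 := by
  simp [weightedChain, add_mul, hi, hj]

theorem isUnit_of_isSymm_weightedChain_mul (hij : i ≠ j) (hik : i ≠ k) (hjk : j ≠ k)
    (hz : IsLeftRegular z) (hY : Y.IsSymm) (hNY : (weightedChain i j k z * Y).IsSymm)
    (hYW : Y * W = 1) : IsUnit z := by
  have hj (t : n) (hti : t ≠ i) (htj : t ≠ j) : Y j t = 0 := by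
    have h := hNY.apply i t
    rw [weightedChain_mul_apply_first hij, weightedChain_mul_apply_of_ne hti htj] at h
    exact hz (h.symm.trans (mul_zero z).symm)
  have hk (t : n) (hti : t ≠ i) (htj : t ≠ j) : Y k t = 0 := by
    have h := hNY.apply j t
    rw [weightedChain_mul_apply_second hij, weightedChain_mul_apply_of_ne hti htj] at h
    exact (hz.pow 2) (h.symm.trans (mul_zero (z ^ 2)).symm)
  have hkj : Y k j = 0 := hY.apply j k ▸ hj k hik.symm hjk.symm
  have hjj : Y j j = z * Y k i := by
    have h := hNY.apply i j
    rw [weightedChain_mul_apply_first hij, weightedChain_mul_apply_second hij, sq, mul_assoc] at h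
    exact hz h.symm
  have hrow_k (t : n) : Y k i * W i t = (1 : Matrix n n R) k t := by
    rw [← hYW, mul_apply, Finset.sum_eq_single i (fun l _ hl ↦ ?_) (by simp)]
    obtain rfl | hlj := eq_or_ne l j
    · rw [hkj, zero_mul]
    · rw [hk l hl hlj, zero_mul]
  have hrow_j : Y j i * W i j + Y j j * W j j = 1 := by
    rw [← one_apply_eq (α := R) j, ← hYW, mul_apply, Finset.sum_eq_add i j hij
      (fun l _ hl ↦ by rw [hj l hl.1 hl.2, zero_mul]) (by simp) (by simp)]
  have hki : IsUnit (Y k i) := .of_mul_eq_one _ ((hrow_k k).trans (one_apply_eq k))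
  have hWij : W i j = 0 := by
    rw [← hki.mul_right_eq_zero, hrow_k, one_apply_ne hjk.symm]
  rw [hWij, mul_zero, zero_add, hjj, mul_assoc] at hrow_j
  exact .of_mul_eq_one _ hrow_j

theorem isUnit_of_isSymmProduct_one_add_weightedChain (hij : i ≠ j) (hik : i ≠ k) (hjk : j ≠ k)
    (hz : IsLeftRegular z) (h : IsSymmProduct (1 + weightedChain i j k z)) : IsUnit z := by
  obtain ⟨Y, Z, hY, hZ, hYZ⟩ := h
  obtain ⟨V, hV⟩ := (isNilpotent_weightedChain hij hik hjk (z := z)).isUnit_one_add.exists_right_inv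
  refine isUnit_of_isSymm_weightedChain_mul hij hik hjk hz hY (W := Z * V) ?_ ?_
  · have hNY : weightedChain i j k z * Y = Y * Z * Yᵀ - Y := by
      rw [hY.eq, ← hYZ, add_mul, one_mul, add_sub_cancel_left]
    exact hNY ▸ (isSymm_mul_mul_transpose Y hZ).sub hY
  · rw [← mul_assoc, ← hYZ, hV]

end Obstruction

variable {n d : ℕ}

/-- The `i`-th coordinate as a holomorphic function on `ℂᵈ`. -/
def coordinate (i : Fin d) : (affineSpace d).holAlgebra := ⟨fun x ↦ x i, hol_affineSpace_apply i⟩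

theorem isLeftRegular_coordinate (i : Fin d) : IsLeftRegular (coordinate i) := by
  intro f g hfg
  have hdense : Dense ((fun x : Fin d → ℂ ↦ x i) ⁻¹' {0}ᶜ) :=
    (dense_compl_singleton 0).preimage (isOpenMap_eval i)
  refine Subtype.ext ((continuous_of_hol_affineSpace f.2).ext_on hdense
    (continuous_of_hol_affineSpace g.2) fun x hx ↦ ?_)
  exact mul_left_cancel₀ hx (congr_fun (congr_arg Subtype.val hfg) x)

theorem not_isUnit_coordinate (i : Fin d) : ¬ IsUnit (coordinate i) := fun h ↦
  not_isUnit_zero (h.map ((affineSpace d).eval 0))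

theorem SufficesOmega.leviBlock_mem_siegelProduct {K : ℕ} (h : SufficesOmega n d K)
    {A : Matrix (Fin n) (Fin n) (affineSpace d).holAlgebra} (hA : IsUnit A.det) :
    leviBlock false A ∈ siegelProduct (Fin n) (affineSpace d).holAlgebra false K := by
  have hmem (x) : (leviBlock false A).map ((affineSpace d).eval x) ∈ symplecticGroup (Fin n) ℂ :=
    SymplecticGroup.map_mem (leviBlock_mem_symplecticGroup hA false) _
  have hhol := (affineSpace d).holMatrix_map_eval (leviBlock false A)
  have hcont : Continuous fun x ↦ (leviBlock false A).map ((affineSpace d).eval x) :=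
    continuous_matrix fun i j ↦ continuous_of_hol_affineSpace (hhol i j)
  let f : C(Fin d → ℂ, symplecticGroup (Fin n) ℂ) := ⟨fun x ↦ ⟨_, hmem x⟩, hcont.subtype_mk hmem⟩
  have hf : f.Nullhomotopic := by simpa using (id_nullhomotopic (Fin d → ℂ)).comp_right f
  obtain ⟨F, hF, hFf⟩ := factorsOmega_iff.1
    (h _ (affineSpace d) isStein_affineSpace hasDim_affineSpace f hf hhol)
  rwa [← (affineSpace d).matrix_ext_eval hFf]

theorem not_sufficesOmega_five (hn : 3 ≤ n) (hd : 1 ≤ d) : ¬ SufficesOmega n d 5 := by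
  intro h
  let z := coordinate (⟨0, hd⟩ : Fin d)
  let i : Fin n := ⟨0, by omega⟩
  let j : Fin n := ⟨1, by omega⟩
  let k : Fin n := ⟨2, hn⟩
  have hij : i ≠ j := by simp [i, j]
  have hik : i ≠ k := by simp [i, k]
  have hjk : j ≠ k := by simp [j, k]
  have hunit : IsUnit (1 + (1 + weightedChain i j k z)) := by
    rw [← add_assoc, one_add_one_eq_two]
    refine (isNilpotent_weightedChain hij hik hjk).isUnit_add_left_of_commute ?_
      (Nat.cast_commute 2 _).symm
    simpa only [map_ofNat] using (IsUnit.mk0 (2 : ℂ) two_ne_zero).map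
      (algebraMap ℂ (Matrix (Fin n) (Fin n) (affineSpace d).holAlgebra))
  have hsymm := isSymmProduct_sub_one_of_leviBlock_mem_siegelProduct_five
    (h.leviBlock_mem_siegelProduct ((isUnit_iff_isUnit_det _).1 hunit))
  rw [add_sub_cancel_left] at hsymm
  exact not_isUnit_coordinate _ (isUnit_of_isSymmProduct_one_add_weightedChain hij hik hjk
    (isLeftRegular_coordinate _) hsymm)

theorem SufficesOmega.mono {K L : ℕ} (hKL : K ≤ L) (h : SufficesOmega n d K) :
    SufficesOmega n d L := fun X _ 𝒪 hX hdim f hf hhol ↦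
  have ⟨F, hF, hFf⟩ := factorsOmega_iff.1 (h X 𝒪 hX hdim f hf hhol)
  factorsOmega_iff.2 ⟨F, alternatingProduct_mono _ false hKL hF, hFf⟩

theorem six_le_ksymp (hn : 3 ≤ n) (hd : 1 ≤ d) : 6 ≤ Ksymp n d := by
  refine le_iInf₂ fun K hK ↦ ?_
  by_contra! hlt
  exact not_sufficesOmega_five hn hd (hK.mono (Nat.le_of_lt_succ (by exact_mod_cast hlt)))

end LowerBound

theorem theorem1p3_general (n d : ℕ) :
    (3 ≤ n → 1 ≤ d → 6 ≤ Ksymp n d) ∧ Ksymp n d ≤ 7 * KsympTilde n d ∧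
      (n ≤ 3 → Ksymp n d ≤ 4 * KsympTilde n d) :=
  ⟨six_le_ksymp,
    ksymp_le_mul_ksympTilde (c := 7) (by norm_num) fun K hK X _ 𝒪 hX hdim f hf hhol ↦
      (hK X 𝒪 hX hdim f hf hhol).factorsOmega_mul
        (alternatingProduct_unitriangularSymplectic_subset_seven false K),
    fun hn ↦ ksymp_le_mul_ksympTilde (c := 4) (by norm_num) fun K hK X _ 𝒪 hX hdim f hf hhol ↦
      (hK X 𝒪 hX hdim f hf hhol).factorsOmega_mul
        (alternatingProduct_unitriangularSymplectic_subset_four hn false K)⟩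

theorem theorem1p3 (n d : ℕ) :
    (4 ≤ n → (1 ≤ d → 6 ≤ Ksymp n d) ∧ Ksymp n d ≤ 7 * KsympTilde n d) ∧
      (n = 2 ∨ n = 3 → Ksymp n d ≤ 4 * KsympTilde n d) := by
  obtain ⟨hlower, hseven, hfour⟩ := theorem1p3_general n d
  exact ⟨fun hn ↦ ⟨hlower (by omega), hseven⟩, fun hn ↦ hfour (by omega)⟩
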